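/- Let $\mathcal H$ and $\mathcal G$ be real Hilbert spaces and set $\mathscr Q_{\mathcal H}=\|\cdot\|^2/2$ on $\mathcal H$ and $\mathscr Q_{\mathcal G}=\|\cdot\|^2/2$ on $\mathcal G$. The conjugate of a function $f\colon\mathcal H\to[-\infty,+\infty]$ is $f^*\colon u\mapsto\sup_{x\in\mathcal H}(\langle x,u\rangle-f(x))$ (and likewise on $\mathcal G$), and the infimal convolution of $f_1,f_2\colon\mathcal G\to\left]-\infty,+\infty\right]$ is $(f_1\mathbin{\square}f_2)(x)=\inf_{z\in\mathcal G}(f_1(z)+f_2(x-z))$. Let $L\colon\mathcal H\to\mathcal G$ be a bounded linear operator. For a function $h\colon\mathcal G\to\left]-\infty,+\infty\right]$ that is proper (i.e. not identically $+\infty$), the proximal composition of $h$ with $L$ is $$L\diamond h=\big((h^*\mathbin{\square}\mathscr Q_{\mathcal G})\circ L\big)^*-\mathscr Q_{\mathcal H},$$ and the proximal cocomposition of $h$ with $L$ is $L\mathbin{\blacklozenge}h=(L\diamond h^*)^*$. **Proposition.** Suppose that $0<\|L\|\le 1$, let $\alpha\in\left]0,+\infty\right[$, let $g\colon\mathcal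 G\to\mathbb R$ be convex and (Fréchet) differentiable with $\alpha^{-1}$-Lipschitzian gradient, and set $\beta=(\alpha+1)\|L\|^{-2}-1$. Then $\beta>0$, and $L\mathbin{\blacklozenge}g$ is real-valued and (Fréchet) differentiable on $\mathcal H$, and its gradient is $\beta^{-1}$-Lipschitzian. -/

import Mathlib

/-- The canonical quadratic form `‖x‖² / 2` of `E`, as an extended-real-valued function. -/
noncomputable def canonicalQuad {E : Type*} [NormedAddCommGroup E] (x : E) : EReal :=
  ((‖x‖ ^ 2 / 2 : ℝ) : EReal)

/-- The (Fenchel) conjugate `f^*(u) = sup_x (⟪x, u⟫ - f x)` of `f : E → [-∞, +∞]`. The first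
term of the difference is always finite, so no indeterminate form occurs. -/
noncomputable def fenchelConj {E : Type*} [NormedAddCommGroup E] [InnerProductSpace ℝ E]
    (f : E → EReal) (u : E) : EReal :=
  ⨆ x : E, ((inner ℝ x u : ℝ) : EReal) - f x

/-- The infimal convolution `(f □ g)(x) = inf_z (f z + g (x - z))`. (It is only used below with a
finite-valued `g`, so no indeterminate form occurs.) -/
noncomputable def infConv {E : Type*} [AddCommGroup E]
    (f g : E → EReal) (x : E) : EReal :=
  ⨅ z : E, f z + g (x - z)

/-- The proximal composition `((g^* □ 𝒬_G) ∘ L)^* - 𝒬_H` of `g` with `L`. -/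
noncomputable def proxComp {H G : Type*} [NormedAddCommGroup H] [InnerProductSpace ℝ H]
    [NormedAddCommGroup G] [InnerProductSpace ℝ G]
    (L : H →L[ℝ] G) (g : G → EReal) (x : H) : EReal :=
  fenchelConj (fun u : H => infConv (fenchelConj g) canonicalQuad (L u)) x - canonicalQuad x

/-- The proximal cocomposition of `g` with `L`: the conjugate of the proximal composition of the
conjugate `g^*` with `L`. -/
noncomputable def proxCocomp {H G : Type*} [NormedAddCommGroup H] [InnerProductSpace ℝ H]
    [NormedAddCommGroup G] [InnerProductSpace ℝ G]
    (L : H →L[ℝ] G) (g : G → EReal) : H → EReal :=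
  fenchelConj (proxComp L (fenchelConj g))

open scoped InnerProductSpace

/-! The cocoercivity constant of the gradient is tracked through each operation. Baillon–Haddad
makes `gradient g` cocoercive with constant `α`; the Moreau envelope adds 1; composing with `L`
divides by `‖L‖ ^ 2`, giving `β + 1 > 1`; supremal deconvolution by the quadratic subtracts 1. A
`β`-cocoercive subgradient selection is a `β⁻¹`-Lipschitzian gradient. Since `g` equals its
biconjugate, the cocomposition is the conjugate of `f^* - 𝒬` with `f = (g □ 𝒬) ∘ L`, which is this
deconvolution of `f`. Every supremum and infimum that must be evaluated is attained at an explicit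
point supplied by a subgradient. -/

section Convex

variable {E : Type*} [NormedAddCommGroup E] [InnerProductSpace ℝ E]

/-- `p` selects a subgradient of `f` at every point, and `p` is `c`-cocoercive. -/
structure HasCocoerciveSubgradient (f : E → ℝ) (p : E → E) (c : ℝ) : Prop where
  subgradient : ∀ x y, f x + ⟪p x, y - x⟫_ℝ ≤ f y
  cocoercive : ∀ x y, c * ‖p x - p y‖ ^ 2 ≤ ⟪p x - p y, x - y⟫_ℝ

namespace HasCocoerciveSubgradient

variable {f : E → ℝ} {p : E → E} {c : ℝ}

theorem norm_sub_le (h : HasCocoerciveSubgradient f p c) (hc : 0 < c) (x y : E) :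
    ‖p x - p y‖ ≤ c⁻¹ * ‖x - y‖ := by
  have h1 := (h.cocoercive x y).trans (real_inner_le_norm _ _)
  rw [inv_mul_eq_div, le_div_iff₀ hc]
  rcases (norm_nonneg (p x - p y)).eq_or_lt with h0 | h0
  · rw [← h0]; simp
  · refine le_of_mul_le_mul_left ?_ h0
    linarith

theorem lipschitzWith (h : HasCocoerciveSubgradient f p c) (hc : 0 < c) :
    LipschitzWith (Real.toNNReal c⁻¹) p := by
  refine LipschitzWith.of_dist_le_mul fun x y => ?_
  rw [dist_eq_norm, dist_eq_norm, Real.coe_toNNReal _ (inv_nonneg.2 hc.le)]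
  exact h.norm_sub_le hc x y

theorem hasGradientAt [CompleteSpace E] (h : HasCocoerciveSubgradient f p c) (hc : 0 < c) (x : E) :
    HasGradientAt f (p x) x := by
  rw [hasGradientAt_iff_isLittleO]
  refine Asymptotics.IsBigO.trans_isLittleO (g := fun y => ‖y - x‖ ^ 2) ?_
    (Asymptotics.isLittleO_pow_sub_sub x one_lt_two)
  -- The two subgradient inequalities trap the remainder between 0 and `⟪p y - p x, y - x⟫`.
  refine Asymptotics.IsBigO.of_bound c⁻¹ (Filter.Eventually.of_forall fun y => ?_)
  have h1 := h.subgradient x y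
  have h2 := h.subgradient y x
  have h3 : ⟪p y - p x, y - x⟫_ℝ ≤ c⁻¹ * ‖y - x‖ ^ 2 := by
    refine (real_inner_le_norm _ _).trans ?_
    have := mul_le_mul_of_nonneg_right (h.norm_sub_le hc y x) (norm_nonneg (y - x))
    linarith
  rw [inner_sub_left] at h3
  rw [← neg_sub y x, inner_neg_right] at h2
  rw [Real.norm_of_nonneg (by linarith), Real.norm_of_nonneg (by positivity)]
  linarith

theorem gradient_eq [CompleteSpace E] (h : HasCocoerciveSubgradient f p c) (hc : 0 < c) :
    gradient f = p :=
  funext fun x => (h.hasGradientAt hc x).gradient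

end HasCocoerciveSubgradient

/-- A differentiable function whose gradient is `K`-Lipschitzian lies below the quadratic models
of curvature `K`. -/
theorem le_quadratic_of_lipschitz_gradient [CompleteSpace E] {f : E → ℝ} {p : E → E} {K : ℝ}
    (hf : ∀ x, HasGradientAt f (p x) x) (hp : ∀ x y, ‖p x - p y‖ ≤ K * ‖x - y‖) (x y : E) :
    f y ≤ f x + ⟪p x, y - x⟫_ℝ + K / 2 * ‖y - x‖ ^ 2 := by
  set d := y - x with hd
  let φ : ℝ → ℝ := fun t => f (x + t • d) - t * ⟪p x, d⟫_ℝ - K / 2 * ‖d‖ ^ 2 * t ^ 2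
  have hline : ∀ t : ℝ, HasDerivAt (fun t : ℝ => x + t • d) d t := fun t => by
    simpa using ((hasDerivAt_id t).smul_const d).const_add x
  have hφ : ∀ t, HasDerivAt φ (⟪p (x + t • d), d⟫_ℝ - ⟪p x, d⟫_ℝ - K * ‖d‖ ^ 2 * t) t := fun t => by
    have h1 : HasDerivAt (fun t : ℝ => f (x + t • d)) ⟪p (x + t • d), d⟫_ℝ t := by
      simpa [Function.comp_def] using (hf (x + t • d)).hasFDerivAt.comp_hasDerivAt t (hline t)
    have h2 := (h1.sub ((hasDerivAt_id t).mul_const ⟪p x, d⟫_ℝ)).sub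
      ((hasDerivAt_pow 2 t).const_mul (K / 2 * ‖d‖ ^ 2))
    refine h2.congr_deriv ?_
    simp; ring
  have hanti : AntitoneOn φ (Set.Icc 0 1) := by
    refine antitoneOn_of_deriv_nonpos (convex_Icc 0 1)
      (fun t _ => (hφ t).continuousAt.continuousWithinAt)
      (fun t _ => (hφ t).differentiableAt.differentiableWithinAt) fun t ht => ?_
    rw [interior_Icc] at ht
    rw [(hφ t).deriv, ← inner_sub_left]
    have h1 := real_inner_le_norm (p (x + t • d) - p x) d
    have h2 := hp (x + t • d) x
    rw [add_sub_cancel_left, norm_smul, Real.norm_of_nonneg ht.1.le] at h2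
    have h3 := mul_le_mul_of_nonneg_right h2 (norm_nonneg d)
    linarith
  have h := hanti (Set.left_mem_Icc.2 zero_le_one) (Set.right_mem_Icc.2 zero_le_one) zero_le_one
  simp only [φ, hd] at h
  simp at h
  linarith

theorem ConvexOn.add_inner_gradient_le [CompleteSpace E] {f : E → ℝ} {v x : E}
    (hf : ConvexOn ℝ Set.univ f) (hv : HasGradientAt f v x) (y : E) :
    f x + ⟪v, y - x⟫_ℝ ≤ f y := by
  have hc : ConvexOn ℝ Set.univ (f ∘ AffineMap.lineMap (k := ℝ) x y) := by
    simpa using hf.comp_affineMap (AffineMap.lineMap (k := ℝ) x y)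
  have hd : HasDerivAt (f ∘ AffineMap.lineMap (k := ℝ) x y) ⟪v, y - x⟫_ℝ 0 := by
    have h0 : HasGradientAt f v (AffineMap.lineMap (k := ℝ) x y (0 : ℝ)) := by simpa using hv
    simpa using h0.hasFDerivAt.comp_hasDerivAt (0 : ℝ) AffineMap.hasDerivAt_lineMap
  have h := hc.le_slope_of_hasDerivAt (Set.mem_univ _) (Set.mem_univ _) zero_lt_one hd
  simp [slope_def_field] at h
  linarith

/-- The Baillon–Haddad theorem. -/
theorem ConvexOn.hasCocoerciveSubgradient [CompleteSpace E] {f : E → ℝ} {p : E → E} {α : ℝ}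
    (hα : 0 < α) (hf : ConvexOn ℝ Set.univ f) (hfp : ∀ x, HasGradientAt f (p x) x)
    (hp : ∀ x y, ‖p x - p y‖ ≤ α⁻¹ * ‖x - y‖) : HasCocoerciveSubgradient f p α := by
  have key : ∀ x y, f x + ⟪p x, y - x⟫_ℝ + α / 2 * ‖p y - p x‖ ^ 2 ≤ f y := fun x y => by
    -- The test point is a gradient step of length `α` from `y` for `f - ⟪p x, ·⟫`; it minimizes the
    -- quadratic upper model at `y`.
    have h1 := hf.add_inner_gradient_le (hfp x) (y - α • (p y - p x))
    have h2 := le_quadratic_of_lipschitz_gradient hfp hp y (y - α • (p y - p x))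
    have h3 : ⟪p y, p y - p x⟫_ℝ - ⟪p x, p y - p x⟫_ℝ = ‖p y - p x‖ ^ 2 := by
      rw [← inner_sub_left, real_inner_self_eq_norm_sq]
    rw [sub_right_comm, inner_sub_right, inner_smul_right] at h1
    rw [sub_sub_cancel_left, inner_neg_right, inner_smul_right, norm_neg, norm_smul,
      Real.norm_of_nonneg hα.le] at h2
    have h4 : α⁻¹ / 2 * (α * ‖p y - p x‖) ^ 2 = α / 2 * ‖p y - p x‖ ^ 2 := by
      field_simp
    rw [h4] at h2
    have h5 := congrArg (α * ·) h3
    simp only [mul_sub] at h5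
    linarith
  refine ⟨fun x => hf.add_inner_gradient_le (hfp x), fun x y => ?_⟩
  have h1 := key x y
  have h2 := key y x
  rw [norm_sub_rev] at h1
  rw [← neg_sub x y, inner_neg_right] at h1
  rw [inner_sub_left]
  linarith

namespace HasCocoerciveSubgradient

variable {f : E → ℝ} {p : E → E} {c : ℝ}

theorem comp_continuousLinearMap {F : Type*} [NormedAddCommGroup F] [InnerProductSpace ℝ F]
    [CompleteSpace E] [CompleteSpace F] (h : HasCocoerciveSubgradient f p c) (hc : 0 ≤ c)
    (L : F →L[ℝ] E) (hL : 0 < ‖L‖) :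
    HasCocoerciveSubgradient (f ∘ L) (fun x => L.adjoint (p (L x))) (c * (‖L‖ ^ 2)⁻¹) := by
  refine ⟨fun x y => ?_, fun x y => ?_⟩
  · rw [ContinuousLinearMap.adjoint_inner_left, map_sub]
    exact h.subgradient _ _
  · rw [← map_sub, ContinuousLinearMap.adjoint_inner_left, map_sub L]
    refine le_trans ?_ (h.cocoercive _ _)
    rw [mul_assoc]
    refine mul_le_mul_of_nonneg_left ?_ hc
    rw [inv_mul_eq_div, div_le_iff₀ (by positivity), ← mul_pow, mul_comm]
    refine pow_le_pow_left₀ (norm_nonneg _) ?_ 2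
    simpa using L.adjoint.le_opNorm (p (L x) - p (L y))

/-- The resolvent equation of a cocoercive operator is solvable. -/
theorem exists_add_eq [CompleteSpace E] (h : HasCocoerciveSubgradient f p c) (hc : 0 < c) (x : E) :
    ∃ z, z + p z = x := by
  -- With `1 - s = 2 * c * s`, cocoercivity makes the cross term absorb the `‖p z - p w‖ ^ 2` term
  -- in `‖T z - T w‖ ^ 2`, leaving the contraction factor `s`.
  set s : ℝ := (1 + 2 * c)⁻¹ with hs
  have hs0 : 0 < s := by positivity
  have hs1 : s < 1 := inv_lt_one_of_one_lt₀ (by linarith)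
  have hsc : 1 - s = 2 * c * s := by rw [hs]; field_simp; ring
  let T : E → E := fun z => s • z - (1 - s) • (p z - x)
  have hT : ContractingWith s.toNNReal T := by
    refine ⟨by simpa using hs1, LipschitzWith.of_dist_le_mul fun z w => ?_⟩
    rw [dist_eq_norm, dist_eq_norm, Real.coe_toNNReal _ hs0.le]
    refine le_of_sq_le_sq ?_ (by positivity)
    have h1 : T z - T w = s • (z - w) - (1 - s) • (p z - p w) := by
      simp only [T]; module
    have h2 := h.cocoercive z w
    rw [h1, norm_sub_sq_real, norm_smul, norm_smul, inner_smul_left, inner_smul_right,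
      Real.norm_of_nonneg hs0.le, Real.norm_of_nonneg (by linarith), real_inner_comm, hsc]
    have h3 := mul_le_mul_of_nonneg_left h2 (by positivity : 0 ≤ 4 * c * s ^ 2)
    simp only [conj_trivial]
    nlinarith
  have hfix : T (hT.fixedPoint T) = hT.fixedPoint T := hT.fixedPoint_isFixedPt
  refine ⟨hT.fixedPoint T, ?_⟩
  set z := hT.fixedPoint T
  have h1 : (1 - s) • (z + p z - x) = 0 := by
    have : (1 - s) • (z + p z - x) = z - T z := by simp only [T]; module
    rw [this, hfix, sub_self]
  rcases smul_eq_zero.1 h1 with h2 | h2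
  · linarith
  · exact sub_eq_zero.1 h2

theorem exists_sub_eq [CompleteSpace E] (h : HasCocoerciveSubgradient f p c) (hc : 1 < c) (x : E) :
    ∃ w, w - p w = x := by
  have hc0 : 0 < c := zero_lt_one.trans hc
  have hT : ContractingWith (Real.toNNReal c⁻¹) (fun w => x + p w) := by
    refine ⟨by simpa using inv_lt_one_of_one_lt₀ hc, ?_⟩
    refine LipschitzWith.of_dist_le_mul fun z w => ?_
    simpa using (h.lipschitzWith hc0).dist_le_mul z w
  exact ⟨_, sub_eq_iff_eq_add.2 hT.fixedPoint_isFixedPt.symm⟩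

/-- The Moreau envelope of a function with a cocoercive subgradient. -/
theorem exists_moreauEnvelope [CompleteSpace E] (h : HasCocoerciveSubgradient f p c) (hc : 0 < c) :
    ∃ (e : E → ℝ) (q : E → E), HasCocoerciveSubgradient e q (c + 1) ∧
      (∀ x z, e x ≤ f z + ‖x - z‖ ^ 2 / 2) ∧ ∀ x, ∃ z, e x = f z + ‖x - z‖ ^ 2 / 2 := by
  -- `z x` is the proximal point of `x`, so `x - z x = p (z x)`.
  choose z hz using h.exists_add_eq hc
  have hle : ∀ x w, f (z x) + ‖p (z x)‖ ^ 2 / 2 ≤ f w + ‖x - w‖ ^ 2 / 2 := fun x w => by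
    have h1 := h.subgradient (z x) w
    have h2 : x - w = p (z x) - (w - z x) := by nth_rewrite 1 [← hz x]; abel
    rw [h2, norm_sub_sq_real]
    nlinarith [sq_nonneg ‖w - z x‖]
  refine ⟨fun x => f (z x) + ‖p (z x)‖ ^ 2 / 2, fun x => p (z x), ⟨fun x y => ?_, fun x y => ?_⟩,
    hle, fun x => ⟨z x, ?_⟩⟩
  · have h1 := h.subgradient (z x) (z y)
    have h2 : y - x = (z y - z x) + (p (z y) - p (z x)) := by
      nth_rewrite 1 [← hz x, ← hz y]; abel
    have h3 := norm_sub_sq_real (p (z y)) (p (z x))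
    rw [h2, inner_add_right, inner_sub_right (p (z x)) (p (z y)), real_inner_self_eq_norm_sq]
    rw [real_inner_comm] at h3
    nlinarith [sq_nonneg ‖p (z y) - p (z x)‖]
  · have h1 := h.cocoercive (z x) (z y)
    have h2 : x - y = (z x - z y) + (p (z x) - p (z y)) := by
      nth_rewrite 1 [← hz x, ← hz y]; abel
    rw [h2, inner_add_right, real_inner_self_eq_norm_sq]
    linarith
  · have h2 : x - z x = p (z x) := by nth_rewrite 1 [← hz x]; abel
    rw [h2]

/-- The supremal deconvolution by `‖·‖² / 2` of a function whose subgradient is cocoercive with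
constant larger than one. -/
theorem exists_quadDeconvolution [CompleteSpace E] (h : HasCocoerciveSubgradient f p c)
    (hc : 1 < c) :
    ∃ (d : E → ℝ) (q : E → E), HasCocoerciveSubgradient d q (c - 1) ∧
      (∀ u v, f (u + v) - ‖v‖ ^ 2 / 2 ≤ d u) ∧
      ∀ u, d u = f (u + q u) - ‖q u‖ ^ 2 / 2 ∧ p (u + q u) = q u := by
  have hc0 : 0 < c := zero_lt_one.trans hc
  -- `u + v = w u` is the critical point of `v ↦ f (u + v) - ‖v‖ ^ 2 / 2`; it is a maximizer because
  -- `f` has curvature at most `c⁻¹ < 1`.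
  choose w hw using h.exists_sub_eq hc
  have hw' : ∀ u, u + p (w u) = w u := fun u => by nth_rewrite 1 [← hw u]; abel
  have hle : ∀ u v, f (u + v) - ‖v‖ ^ 2 / 2 ≤ f (w u) - ‖p (w u)‖ ^ 2 / 2 := fun u v => by
    have h1 := le_quadratic_of_lipschitz_gradient (h.hasGradientAt hc0) (h.norm_sub_le hc0)
      (w u) (u + v)
    have h2 : u + v - w u = v - p (w u) := by nth_rewrite 1 [← hw u]; abel
    have h3 : c⁻¹ * ‖v - p (w u)‖ ^ 2 ≤ ‖v - p (w u)‖ ^ 2 :=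
      mul_le_of_le_one_left (sq_nonneg _) (inv_le_one_of_one_le₀ hc.le)
    have h4 := norm_sub_sq_real v (p (w u))
    rw [h2, inner_sub_right, real_inner_self_eq_norm_sq] at h1
    rw [real_inner_comm] at h4
    linarith
  refine ⟨fun u => f (w u) - ‖p (w u)‖ ^ 2 / 2, fun u => p (w u), ⟨fun x y => ?_, fun x y => ?_⟩,
    hle, fun u => ?_⟩
  · have h1 := hle y (p (w x))
    have h2 := h.subgradient (w x) (y + p (w x))
    have h3 : y + p (w x) - w x = y - x := by nth_rewrite 2 [← hw' x]; abel
    rw [h3] at h2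
    linarith
  · have h1 := h.cocoercive (w x) (w y)
    have h2 : w x - w y = (x - y) + (p (w x) - p (w y)) := by
      nth_rewrite 1 [← hw' x, ← hw' y]; abel
    rw [h2, inner_add_right, real_inner_self_eq_norm_sq] at h1
    linarith
  · simp only [hw', and_self]

end HasCocoerciveSubgradient

/-- Equality case of Fenchel–Young: the supremum is attained at `x`. -/
theorem fenchelConj_eq_of_subgradient {f : E → ℝ} {v x : E}
    (h : ∀ y, f x + ⟪v, y - x⟫_ℝ ≤ f y) :
    fenchelConj (fun y => (f y : EReal)) v = ((⟪x, v⟫_ℝ - f x : ℝ) : EReal) := by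
  refine le_antisymm (iSup_le fun y => ?_) (le_iSup_of_le x (by rw [EReal.coe_sub]))
  rw [← EReal.coe_sub, EReal.coe_le_coe_iff]
  have h1 := h y
  rw [inner_sub_right, real_inner_comm, real_inner_comm x v] at h1
  linarith

theorem inner_sub_le_fenchelConj (f : E → ℝ) (x u : E) :
    ((⟪x, u⟫_ℝ - f x : ℝ) : EReal) ≤ fenchelConj (fun y => (f y : EReal)) u :=
  le_iSup_of_le x (by rw [EReal.coe_sub])

theorem fenchelConj_fenchelConj_of_subgradient {f : E → ℝ} {p : E → E}
    (h : ∀ x y, f x + ⟪p x, y - x⟫_ℝ ≤ f y) :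
    fenchelConj (fenchelConj fun y => (f y : EReal)) = fun y => (f y : EReal) := by
  funext x
  refine le_antisymm (iSup_le fun u => ?_) (le_iSup_of_le (p x) ?_)
  · refine (EReal.sub_le_sub le_rfl (inner_sub_le_fenchelConj f x u)).trans ?_
    rw [← EReal.coe_sub, EReal.coe_le_coe_iff, real_inner_comm]
    linarith
  · rw [fenchelConj_eq_of_subgradient (h x), ← EReal.coe_sub, EReal.coe_le_coe_iff,
      real_inner_comm]
    linarith

theorem infConv_canonicalQuad_eq {V : Type*} [NormedAddCommGroup V] {f e : V → ℝ}
    (hle : ∀ x z, e x ≤ f z + ‖x - z‖ ^ 2 / 2)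
    (hex : ∀ x, ∃ z, e x = f z + ‖x - z‖ ^ 2 / 2) (x : V) :
    infConv (fun y => (f y : EReal)) canonicalQuad x = (e x : EReal) := by
  obtain ⟨z, hz⟩ := hex x
  refine le_antisymm (iInf_le_of_le z ?_) (le_iInf fun z => ?_)
  · rw [canonicalQuad, ← EReal.coe_add, hz]
  · rw [canonicalQuad, ← EReal.coe_add, EReal.coe_le_coe_iff]
    exact hle x z

/-- Bounding the inner conjugate at `x` below by its value at the test point `u + x` gives `≤`. At
`x = q u` this bound is exact, because `q u` is a subgradient at `u + q u`. -/
theorem fenchelConj_fenchelConj_sub_canonicalQuad {f d : E → ℝ} {p q : E → E}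
    (h : ∀ x y, f x + ⟪p x, y - x⟫_ℝ ≤ f y) (hle : ∀ u v, f (u + v) - ‖v‖ ^ 2 / 2 ≤ d u)
    (hq : ∀ u, d u = f (u + q u) - ‖q u‖ ^ 2 / 2 ∧ p (u + q u) = q u) (u : E) :
    fenchelConj (fun x => fenchelConj (fun y => (f y : EReal)) x - canonicalQuad x) u =
      (d u : EReal) := by
  obtain ⟨hd, hp⟩ := hq u
  refine le_antisymm (iSup_le fun x => ?_) (le_iSup_of_le (q u) ?_)
  · refine (EReal.sub_le_sub le_rfl
      (EReal.sub_le_sub (inner_sub_le_fenchelConj f (u + x) x) le_rfl)).trans ?_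
    rw [canonicalQuad, ← EReal.coe_sub, ← EReal.coe_sub, EReal.coe_le_coe_iff, inner_add_left,
      real_inner_self_eq_norm_sq, real_inner_comm]
    linarith [hle u x]
  · have h1 := fenchelConj_eq_of_subgradient (h (u + q u))
    rw [hp] at h1
    beta_reduce
    rw [h1, canonicalQuad, ← EReal.coe_sub, ← EReal.coe_sub, EReal.coe_le_coe_iff, inner_add_left,
      real_inner_self_eq_norm_sq, real_inner_comm, hd]
    linarith

end Convex

theorem proposition5p6 {H G : Type*}
    [NormedAddCommGroup H] [InnerProductSpace ℝ H] [CompleteSpace H]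
    [NormedAddCommGroup G] [InnerProductSpace ℝ G] [CompleteSpace G]
    (L : H →L[ℝ] G) (hL0 : 0 < ‖L‖) (hL1 : ‖L‖ ≤ 1)
    (α : ℝ) (hα : 0 < α)
    (g : G → ℝ) (hconv : ConvexOn ℝ Set.univ g) (hdiff : Differentiable ℝ g)
    (hlip : LipschitzWith (Real.toNNReal α⁻¹) (gradient g))
    (β : ℝ) (hβ : β = (α + 1) * (‖L‖ ^ 2)⁻¹ - 1) :
    0 < β ∧
    ∃ f : H → ℝ,
      (∀ x : H, proxCocomp L (fun y : G => (g y : EReal)) x = (f x : EReal)) ∧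
      Differentiable ℝ f ∧
      LipschitzWith (Real.toNNReal β⁻¹) (gradient f) := by
  -- `‖L‖ ≤ 1` keeps the constant above 1, as the deconvolution requires.
  have hinv : 1 ≤ (‖L‖ ^ 2)⁻¹ := (one_le_inv₀ (by positivity)).2 (pow_le_one₀ hL0.le hL1)
  have hc : 1 < (α + 1) * (‖L‖ ^ 2)⁻¹ := by nlinarith
  have hβ0 : 0 < β := by rw [hβ]; linarith
  have hg : HasCocoerciveSubgradient g (gradient g) α := by
    refine hconv.hasCocoerciveSubgradient hα (fun x => (hdiff x).hasGradientAt) fun x y => ?_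
    simpa only [dist_eq_norm, Real.coe_toNNReal _ (inv_nonneg.2 hα.le)] using hlip.dist_le_mul x y
  obtain ⟨e, r, he, hle, hex⟩ := hg.exists_moreauEnvelope hα
  have heL := he.comp_continuousLinearMap (by positivity) L hL0
  obtain ⟨d, q, hd, hdle, hdq⟩ := heL.exists_quadDeconvolution hc
  rw [← hβ] at hd
  refine ⟨hβ0, d, fun x => ?_, fun x => (hd.hasGradientAt hβ0 x).differentiableAt, ?_⟩
  · have h1 : proxComp L (fenchelConj fun y : G => (g y : EReal)) =
        fun x => fenchelConj (fun y => (((e ∘ L) y : ℝ) : EReal)) x - canonicalQuad x := by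
      funext x
      simp only [proxComp, fenchelConj_fenchelConj_of_subgradient hg.subgradient,
        infConv_canonicalQuad_eq hle hex, Function.comp_apply]
    rw [proxCocomp, h1]
    exact fenchelConj_fenchelConj_sub_canonicalQuad heL.subgradient hdle hdq x
  · rw [hd.gradient_eq hβ0]
    exact hd.lipschitzWith hβ0
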